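/- Let $0<q<1$. For complex $x$, a base $p\in(0,1)$ and an integer $n\ge 0$ put $(x;p)_n=\prod_{k=0}^{n-1}(1-xp^k)$ and $(x;p)_\infty=\prod_{k=0}^{\infty}(1-xp^k)$, and write $(x,y;p)_n=(x;p)_n(y;p)_n$, also for $n=\infty$. Let $a,b\in\mathbb C$ satisfy $|ab/q|<1$ and be such that no denominator below vanishes, i.e. $aq^{2k+2}\neq 1$ and $bq^{2k+2}\ne 1$ for all integers $k\ge 0$. Then both series below converge and $$\frac{(q^2,ab;q^2)_\infty}{(q^2a,q^2b;q^2)_\infty}\sum_{n=0}^\infty\frac{(q^2/a,q^2/b;q^2)_n\,(ab/q)^n}{(q;q)_{2n}}=\sum_{n=0}^\infty\sum_{j=-n}^{n}(1-q^{4n+2})\,q^{2n^2-2j^2-j}\,\frac{(q^2/a,q^2/b;q^2)_n\,(ab)^n}{(q^2a,q^2b;q^2)_n},$$ where, as usual, $(q^2/a;q^2)_n\,a^n$ is read as $\prod_{k=0}^{n-1}(a-q^{2k+2})$, which also gives it a meaning for $a=0$, and likewise for $b$. In particular, for $(a,b)=(0,0),(1,0),(q,-q)$ respectively, the following identities hold,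 all series being convergent: $$\sum_{n=0}^\infty\frac{q^{2n^2+n}}{(q;q)_{2n}}=\frac1{(q^2;q^2)_\infty}\sum_{n=0}^\infty\sum_{j=-n}^n(1-q^{4n+2})\,q^{4n^2-2j^2+2n-j},$$ $$\sum_{n=0}^\infty\frac{(-1)^nq^{n^2}}{(q;q^2)_n}=\sum_{n=0}^\infty\sum_{j=-n}^n(-1)^n(1-q^{4n+2})\,q^{3n^2-2j^2+n-j},$$ $$\sum_{n=0}^\infty\frac{(q^2;q^4)_n(-q)^n}{(q;q)_{2n}}=\frac{(q^2;q^4)_\infty}{(q^4;q^4)_\infty}\sum_{n=0}^\infty\sum_{j=-n}^n(-1)^nq^{2n^2+2n-2j^2-j}.$$ -/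

import Mathlib

/-- The finite `q`-shifted factorial `(a; q)_n = ∏_{k=0}^{n-1} (1 - a q^k)`. -/
noncomputable def qPoch (a q : ℂ) (n : ℕ) : ℂ :=
  ∏ k ∈ Finset.range n, (1 - a * q ^ k)

/-- The infinite `q`-shifted factorial `(a; q)_∞ = ∏_{k=0}^∞ (1 - a q^k)`. -/
noncomputable def qPochInf (a q : ℂ) : ℂ :=
  ∏' k : ℕ, (1 - a * q ^ k)

/-- The infinite product defining `(a; q)_∞` converges for `|q| < 1`. -/
theorem multipliable_qPochInf (a q : ℂ) (hq : ‖q‖ < 1) :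
    Multipliable fun k : ℕ => 1 - a * q ^ k := by
  have h : Summable fun k : ℕ => ‖-(a * q ^ k)‖ := by
    simp only [norm_neg, norm_mul, norm_pow]
    exact (summable_geometric_of_lt_one (norm_nonneg q) hq).mul_left _
  simpa [sub_eq_add_neg] using multipliable_one_add_of_summable h

/-- The product `(x/a; q)_n a^n`, written as the polynomial `∏_{k=0}^{n-1} (a - x q^k)` in `a`,
so that it also has its usual (limiting) value at `a = 0`. -/
noncomputable def qPochDivMulPow (x a q : ℂ) (n : ℕ) : ℂ :=
  ∏ k ∈ Finset.range n, (a - x * q ^ k)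

/-- For `a ≠ 0`, `qPochDivMulPow x a q n` is literally `(x/a; q)_n a^n`. -/
theorem qPochDivMulPow_eq (x a q : ℂ) (n : ℕ) (ha : a ≠ 0) :
    qPochDivMulPow x a q n = qPoch (x / a) q n * a ^ n := by
  induction n with
  | zero => simp [qPochDivMulPow, qPoch]
  | succ n ih =>
    simp only [qPochDivMulPow, qPoch] at ih ⊢
    rw [Finset.prod_range_succ, Finset.prod_range_succ, ih, pow_succ]
    field_simp

section

open Filter Topology Finset

/-! Put `p = q ^ 2`. The formula is Bailey's lemma applied to an explicit Bailey pair: the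
absolutely convergent double series with terms `doubleTerm q a b (r, m)` is summed in two ways.

Along `r + m = n` the factor `transTerm q a b n` comes out, and what remains is the pair relation `∑
α_r / ((p; p)_{n-r} (p; p)_{n+r+1}) = q^{-n} / (q; q)_{2n}` (`sum_antidiagonal_baileyAlpha`). Since
`α_r` is a kernel difference in `r` times a sum over `|j| ≤ r`, Abel summation reduces the left side
to a single sum over `j`. Up to `q^{-n}` this is the coefficient of `x^{2n}` in `1 / ((x; q²)_∞ (xq;
q²)_∞) = 1 / (x; q)_∞`.

For fixed `r` the sum over `m` is a `q`-Gauss sum (`tsum_gaussTerm`) and gives the `r`-th term of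
the other side times a constant (`hasSum_doubleTerm_fiber`). The three identities are
specializations in which the products collapse. -/

theorem summable_sq_mul_norm_prod {c : ℕ → ℂ} {l : ℝ}
    (h : Tendsto (fun n => ‖c n‖) atTop (𝓝 l)) (hl : l < 1) :
    Summable fun n : ℕ => ((n : ℝ) + 1) ^ 2 * ‖∏ k ∈ range n, c k‖ := by
  obtain ⟨r, hlr, hr⟩ := exists_between hl
  -- The ratio of consecutive weights tends to 1, so the polynomial weight leaves the limiting ratio
  -- equal to `l`.
  have h1 : Tendsto (fun n : ℕ => (1 + 1 / ((n : ℝ) + 1)) ^ 2 * ‖c n‖) atTop (𝓝 l) := by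
    simpa using ((tendsto_one_div_add_atTop_nhds_zero_nat (𝕜 := ℝ)).const_add 1).pow 2 |>.mul h
  refine summable_of_ratio_norm_eventually_le hr ?_
  filter_upwards [h1.eventually_le_const hlr] with n hn
  have h2 : ((n : ℝ) + 1 + 1) ^ 2 = (1 + 1 / ((n : ℝ) + 1)) ^ 2 * ((n : ℝ) + 1) ^ 2 := by
    have : (n : ℝ) + 1 ≠ 0 := by positivity
    field_simp
  rw [prod_range_succ, Nat.cast_add_one, h2, Real.norm_of_nonneg (by positivity),
    Real.norm_of_nonneg (by positivity), norm_mul]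
  calc _ = ((1 + 1 / ((n : ℝ) + 1)) ^ 2 * ‖c n‖) *
        (((n : ℝ) + 1) ^ 2 * ‖∏ k ∈ range n, c k‖) := by ring
    _ ≤ _ := mul_le_mul_of_nonneg_right hn (by positivity)

theorem summable_norm_prod {c : ℕ → ℂ} {l : ℝ}
    (h : Tendsto (fun n => ‖c n‖) atTop (𝓝 l)) (hl : l < 1) :
    Summable fun n : ℕ => ‖∏ k ∈ range n, c k‖ := by
  refine (summable_sq_mul_norm_prod h hl).of_nonneg_of_le (fun _ => norm_nonneg _) fun n => ?_
  refine le_mul_of_one_le_left (norm_nonneg _) (one_le_pow₀ ?_)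
  linarith [(Nat.cast_nonneg n : (0 : ℝ) ≤ n)]

/-! ### Finite and infinite `q`-shifted factorials -/

theorem tendsto_qPoch (a p : ℂ) (hp : ‖p‖ < 1) :
    Tendsto (qPoch a p) atTop (𝓝 (qPochInf a p)) :=
  (multipliable_qPochInf a p hp).hasProd.tendsto_prod_nat

theorem qPoch_add (a p : ℂ) (m n : ℕ) :
    qPoch a p (m + n) = qPoch a p m * qPoch (a * p ^ m) p n := by
  simp only [qPoch, prod_range_add, pow_add, mul_assoc]

theorem qPochInf_eq_mul (a p : ℂ) (hp : ‖p‖ < 1) (n : ℕ) :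
    qPochInf a p = qPoch a p n * qPochInf (a * p ^ n) p := by
  refine tendsto_nhds_unique ((tendsto_qPoch a p hp).comp (tendsto_add_atTop_nat n)) ?_
  have : qPoch a p ∘ (fun m => m + n) = fun m => qPoch a p n * qPoch (a * p ^ n) p m := by
    funext m
    simp [add_comm m n, qPoch_add]
  rw [this]
  exact (tendsto_qPoch _ p hp).const_mul _

theorem qPoch_ne_zero {a p : ℂ} (h : ∀ k : ℕ, 1 - a * p ^ k ≠ 0) (n : ℕ) : qPoch a p n ≠ 0 :=
  prod_ne_zero_iff.2 fun k _ => h k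

theorem qPochInf_ne_zero {a p : ℂ} (hp : ‖p‖ < 1) (h : ∀ k : ℕ, 1 - a * p ^ k ≠ 0) :
    qPochInf a p ≠ 0 := by
  have h1 : Summable fun k : ℕ => ‖-(a * p ^ k)‖ := by
    simp only [norm_neg, norm_mul, norm_pow]
    exact (summable_geometric_of_lt_one (norm_nonneg p) hp).mul_left _
  have := tprod_one_add_ne_zero_of_summable (f := fun k : ℕ => -(a * p ^ k))
    (by simpa [sub_eq_add_neg] using h) h1
  simpa [qPochInf, sub_eq_add_neg] using this

theorem one_sub_mul_pow_ne_zero {a p : ℂ} (ha : ‖a‖ < 1) (hp : ‖p‖ < 1) (k : ℕ) :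
    1 - a * p ^ k ≠ 0 := by
  intro h
  have h1 : ‖a * p ^ k‖ = 1 := by rw [← sub_eq_zero.1 h, norm_one]
  rw [norm_mul, norm_pow] at h1
  nlinarith [pow_le_one₀ (n := k) (norm_nonneg p) hp.le, norm_nonneg a, pow_nonneg (norm_nonneg p) k]

/-! ### The `q`-Gauss sum -/

/-- The terms of the series `₂φ₁(C/u, C/v; C; p, uv/C)`, polynomial in `u` and `v`. -/
noncomputable def gaussTerm (p C : ℝ) (u v : ℂ) (n : ℕ) : ℂ :=
  ∏ k ∈ range n, ((u - C * p ^ k) * (v - C * p ^ k) /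
    (C * (1 - (p : ℂ) ^ (k + 1)) * (1 - C * (p : ℂ) ^ k)))

section Gauss

variable {p C : ℝ} (hp0 : 0 < p) (hp1 : p < 1) (hC0 : 0 < C) (hC1 : C < 1) (u v : ℂ)

theorem one_sub_ofReal_mul_pow_ne_zero {p C : ℝ} (hp0 : 0 < p) (hp1 : p < 1) (hC0 : 0 < C)
    (hC1 : C < 1) (k : ℕ) : (1 : ℂ) - C * (p : ℂ) ^ k ≠ 0 :=
  one_sub_mul_pow_ne_zero (by simpa [abs_of_pos hC0]) (by simpa [abs_of_pos hp0]) k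

theorem one_sub_ofReal_pow_succ_ne_zero {p : ℝ} (hp0 : 0 < p) (hp1 : p < 1) (k : ℕ) :
    (1 : ℂ) - (p : ℂ) ^ (k + 1) ≠ 0 := by
  simpa [pow_succ'] using one_sub_ofReal_mul_pow_ne_zero hp0 hp1 hp0 hp1 k

theorem tendsto_ofReal_pow_zero {p : ℝ} (hp0 : 0 < p) (hp1 : p < 1) :
    Tendsto (fun k : ℕ => (p : ℂ) ^ k) atTop (𝓝 0) :=
  tendsto_pow_atTop_nhds_zero_of_norm_lt_one (by simpa [abs_of_pos hp0])

include hp0 hp1 hC0 in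
theorem tendsto_gaussTerm_ratio :
    Tendsto (fun k : ℕ => ‖(u - C * p ^ k) * (v - C * p ^ k) /
      (C * (1 - (p : ℂ) ^ (k + 1)) * (1 - C * (p : ℂ) ^ k))‖) atTop (𝓝 ‖u * v / C‖) := by
  have h := tendsto_ofReal_pow_zero hp0 hp1
  have h1 := (tendsto_add_atTop_iff_nat 1).2 h
  have hC : (C : ℂ) ≠ 0 := by exact_mod_cast hC0.ne'
  have := ((h.const_mul (C : ℂ)).const_sub u).mul ((h.const_mul (C : ℂ)).const_sub v) |>.div
    (((h1.const_sub 1).const_mul (C : ℂ)).mul ((h.const_mul (C : ℂ)).const_sub 1))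
    (by simpa using hC)
  simpa using this.norm

include hp0 hp1 hC0 in
theorem summable_norm_gaussTerm (huv : ‖u * v / C‖ < 1) :
    Summable fun n => ‖gaussTerm p C u v n‖ :=
  summable_norm_prod (tendsto_gaussTerm_ratio hp0 hp1 hC0 u v) huv

include hp0 hp1 hC0 hC1 in
-- Each factor gains `p * p / p = p`, while `(C; p)_n / (C p; p)_n` telescopes to `(1 - C) / (1 - C
-- p^n)`.
theorem gaussTerm_scale (n : ℕ) :
    gaussTerm p (C * p) (u * p) (v * p) n * (1 - C * (p : ℂ) ^ n) =
      p ^ n * gaussTerm p C u v n * (1 - C) := by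
  induction n with
  | zero => simp [gaussTerm]
  | succ n ih =>
    simp only [gaussTerm] at ih ⊢
    rw [prod_range_succ, prod_range_succ, mul_right_comm]
    have h1 := one_sub_ofReal_mul_pow_ne_zero hp0 hp1 hC0 hC1 n
    have h2 := one_sub_ofReal_mul_pow_ne_zero hp0 hp1 hC0 hC1 (n + 1)
    have h3 := one_sub_ofReal_pow_succ_ne_zero hp0 hp1 n
    have h4 : (C : ℂ) ≠ 0 := by exact_mod_cast hC0.ne'
    have h5 : (p : ℂ) ≠ 0 := by exact_mod_cast hp0.ne'
    have h6 : (1 : ℂ) - (C * p : ℝ) * (p : ℂ) ^ n = 1 - C * (p : ℂ) ^ (n + 1) := by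
      push_cast; ring
    rw [h6]
    rw [← eq_div_iff h1] at ih
    rw [ih]
    push_cast
    field_simp
    ring

include hp0 hp1 hC0 hC1 in
-- A contiguous relation in telescoping form: summed over `n`, the right side vanishes, as `1 - p^0
-- = 0` and the terms tend to 0. Hence the sum at `(C, u, v)` is an explicit multiple of the sum at
-- `(C p, u p, v p)`.
theorem gaussTerm_telescope (n : ℕ) :
    (1 - C) * (1 - u * v / C) * gaussTerm p C u v n -
      (1 - u) * (1 - v) * gaussTerm p (C * p) (u * p) (v * p) n =
    (1 - C) * (gaussTerm p C u v n * (1 - (p : ℂ) ^ n) -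
      gaussTerm p C u v (n + 1) * (1 - (p : ℂ) ^ (n + 1))) := by
  have h1 := one_sub_ofReal_mul_pow_ne_zero hp0 hp1 hC0 hC1 n
  have h3 := one_sub_ofReal_pow_succ_ne_zero hp0 hp1 n
  have h4 : (C : ℂ) ≠ 0 := by exact_mod_cast hC0.ne'
  have hs := gaussTerm_scale hp0 hp1 hC0 hC1 u v n
  rw [← eq_div_iff h1] at hs
  have hn : gaussTerm p C u v (n + 1) = gaussTerm p C u v n * ((u - C * p ^ n) * (v - C * p ^ n) /
      (C * (1 - (p : ℂ) ^ (n + 1)) * (1 - C * (p : ℂ) ^ n))) := prod_range_succ _ _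
  rw [hs, hn]
  field_simp
  ring

include hp0 hp1 hC0 hC1 in
theorem tsum_gaussTerm_step (huv : ‖u * v / C‖ < 1) :
    (1 - C) * (1 - u * v / C) * ∑' n, gaussTerm p C u v n =
      (1 - u) * (1 - v) * ∑' n, gaussTerm p (C * p) (u * p) (v * p) n := by
  have hs := (summable_norm_gaussTerm hp0 hp1 hC0 u v huv).of_norm
  have hz : u * p * (v * p) / (C * p : ℝ) = u * v / C * p := by
    have h4 : (C : ℂ) ≠ 0 := by exact_mod_cast hC0.ne'
    have h5 : (p : ℂ) ≠ 0 := by exact_mod_cast hp0.ne'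
    push_cast; field_simp
  have hs' := (summable_norm_gaussTerm hp0 hp1 (mul_pos hC0 hp0) (u * p) (v * p) (by
    rw [hz, norm_mul, Complex.norm_real, Real.norm_of_nonneg hp0.le]
    nlinarith [norm_nonneg (u * v / C)])).of_norm
  have hd := (hs.hasSum.mul_left ((1 - C) * (1 - u * v / C))).sub
    (hs'.hasSum.mul_left ((1 - u) * (1 - v)))
  have hlim : Tendsto (fun n => gaussTerm p C u v n * (1 - (p : ℂ) ^ n)) atTop (𝓝 0) := by
    simpa using hs.tendsto_atTop_zero.mul ((tendsto_ofReal_pow_zero hp0 hp1).const_sub 1)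
  have ht := hd.tendsto_sum_nat
  simp only [gaussTerm_telescope hp0 hp1 hC0 hC1, ← mul_sum, sum_range_sub'] at ht
  have := tendsto_nhds_unique ht ((hlim.const_sub _).const_mul _)
  simp only [pow_zero, sub_self, mul_zero] at this
  exact sub_eq_zero.1 this

include hp0 hp1 hC0 hC1 in
theorem tsum_gaussTerm_iterate (huv : ‖u * v / C‖ < 1) (N : ℕ) :
    qPoch C p N * qPoch (u * v / C) p N * ∑' n, gaussTerm p C u v n =
      qPoch u p N * qPoch v p N *
        ∑' n, gaussTerm p (C * p ^ N) (u * p ^ N) (v * p ^ N) n := by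
  induction N with
  | zero => simp [qPoch]
  | succ N ih =>
    have hz : u * p ^ N * (v * p ^ N) / (C * p ^ N : ℝ) = u * v / C * p ^ N := by
      have h4 : (C : ℂ) ≠ 0 := by exact_mod_cast hC0.ne'
      have h5 : (p : ℂ) ≠ 0 := by exact_mod_cast hp0.ne'
      push_cast; field_simp
    have hpN : p ^ N ≤ 1 := pow_le_one₀ hp0.le hp1.le
    have hpN0 : 0 < p ^ N := pow_pos hp0 N
    have := tsum_gaussTerm_step hp0 hp1 (mul_pos hC0 hpN0) (by nlinarith) (u * p ^ N) (v * p ^ N)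
      (by
        rw [hz, norm_mul, norm_pow, Complex.norm_real, Real.norm_of_nonneg hp0.le]
        nlinarith [norm_nonneg (u * v / C)])
    rw [hz] at this
    simp only [mul_assoc, ← pow_succ] at this
    simp only [qPoch, prod_range_succ] at ih ⊢
    push_cast at this ih ⊢
    linear_combination (1 - C * (p : ℂ) ^ N) * (1 - u * v / C * p ^ N) * ih +
      (∏ x ∈ range N, (1 - u * (p : ℂ) ^ x)) * (∏ x ∈ range N, (1 - v * (p : ℂ) ^ x)) * this

include hp0 hp1 hC0 hC1 in
-- Each factor gains `p^N`, and the denominators `1 - C p^N p^k` only grow with `N`. This supplies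
-- both the dominating series and the decay of every term with `n ≥ 1`.
theorem norm_gaussTerm_scale_le (N n : ℕ) :
    ‖gaussTerm p (C * p ^ N) (u * p ^ N) (v * p ^ N) n‖ ≤ (p ^ N) ^ n * ‖gaussTerm p C u v n‖ := by
  rw [gaussTerm, gaussTerm, norm_prod, norm_prod, ← card_range n, ← prod_const, card_range,
    ← prod_mul_distrib]
  refine prod_le_prod (fun _ _ => norm_nonneg _) fun k _ => ?_
  have h4 : (C : ℂ) ≠ 0 := by exact_mod_cast hC0.ne'
  have h5 : (p : ℂ) ≠ 0 := by exact_mod_cast hp0.ne'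
  have hpN : p ^ N ≤ 1 := pow_le_one₀ hp0.le hp1.le
  have hpN0 : 0 < p ^ N := pow_pos hp0 N
  have hpk : p ^ k ≤ 1 := pow_le_one₀ hp0.le hp1.le
  have hpk0 : 0 < p ^ k := pow_pos hp0 k
  have e1 : (u * p ^ N - (C * p ^ N : ℝ) * p ^ k) * (v * p ^ N - (C * p ^ N : ℝ) * p ^ k) /
      ((C * p ^ N : ℝ) * (1 - (p : ℂ) ^ (k + 1)) * (1 - (C * p ^ N : ℝ) * (p : ℂ) ^ k)) =
      (p ^ N : ℝ) * ((u - C * p ^ k) * (v - C * p ^ k) / (C * (1 - (p : ℂ) ^ (k + 1)))) /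
        (1 - C * p ^ N * p ^ k : ℝ) := by
    push_cast
    rw [← div_div]
    congr 1
    have := one_sub_ofReal_pow_succ_ne_zero hp0 hp1 k
    field_simp
  have e2 : (1 : ℂ) - C * p ^ k = (1 - C * p ^ k : ℝ) := by push_cast; ring
  have hCk : C * p ^ k < 1 := by nlinarith
  have hNk : C * p ^ N * p ^ k ≤ C * p ^ k := by
    have := mul_pos hC0 hpk0
    nlinarith
  rw [e1, e2, ← div_div _ _ ((1 - C * p ^ k : ℝ) : ℂ), norm_div, norm_mul,
    norm_div _ ((1 - C * p ^ k : ℝ) : ℂ), Complex.norm_real, Complex.norm_real, Complex.norm_real, Real.norm_of_nonneg hpN0.le,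
    Real.norm_of_nonneg (by linarith : 0 ≤ 1 - C * p ^ N * p ^ k),
    Real.norm_of_nonneg (by linarith : 0 ≤ 1 - C * p ^ k), ← mul_div_assoc]
  gcongr

include hp0 hp1 hC0 hC1 in
/-- The `q`-analogue of Gauss's summation theorem. -/
theorem tsum_gaussTerm (huv : ‖u * v / C‖ < 1) :
    qPochInf C p * qPochInf (u * v / C) p * ∑' n, gaussTerm p C u v n =
      qPochInf u p * qPochInf v p := by
  have hp : ‖(p : ℂ)‖ < 1 := by simpa [abs_of_pos hp0]
  have hle : ∀ N n, ‖gaussTerm p (C * p ^ N) (u * p ^ N) (v * p ^ N) n‖ ≤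
      (p ^ N) ^ n * ‖gaussTerm p C u v n‖ := norm_gaussTerm_scale_le hp0 hp1 hC0 hC1 u v
  -- As the parameters shrink to 0 only the term `n = 0` survives, so iterating the contiguous
  -- relation leaves just the infinite products.
  have hlim : Tendsto (fun N : ℕ => ∑' n, gaussTerm p (C * p ^ N) (u * p ^ N) (v * p ^ N) n)
      atTop (𝓝 (∑' n : ℕ, if n = 0 then 1 else 0)) := by
    refine tendsto_tsum_of_dominated_convergence
      (summable_norm_gaussTerm hp0 hp1 hC0 u v huv) (fun n => ?_) (Eventually.of_forall fun N n => ?_)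
    · rcases Nat.eq_zero_or_pos n with rfl | hn
      · simp [gaussTerm]
      · rw [if_neg hn.ne']
        refine squeeze_zero_norm (hle · n) ?_
        have h1 : Tendsto (fun N : ℕ => (p ^ N) ^ n) atTop (𝓝 0) := by
          simpa [hn.ne'] using (tendsto_pow_atTop_nhds_zero_of_lt_one hp0.le hp1).pow n
        simpa using h1.mul_const ‖gaussTerm p C u v n‖
    · refine (hle N n).trans (mul_le_of_le_one_left (norm_nonneg _) ?_)
      exact pow_le_one₀ (by positivity) (pow_le_one₀ hp0.le hp1.le)
  rw [tsum_ite_eq] at hlim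
  have h1 := ((tendsto_qPoch C p hp).mul (tendsto_qPoch (u * v / C) p hp)).mul_const
    (∑' n, gaussTerm p C u v n)
  have h2 := ((tendsto_qPoch u p hp).mul (tendsto_qPoch v p hp)).mul hlim
  simp only [tsum_gaussTerm_iterate hp0 hp1 hC0 hC1 u v huv] at h1
  simpa using tendsto_nhds_unique h1 h2

end Gauss

/-! ### Euler's series and the product `(x; q)_∞ = (x; q²)_∞ (xq; q²)_∞` -/

theorem qPoch_self_ne_zero {q : ℂ} (hq : ‖q‖ < 1) (n : ℕ) : qPoch q q n ≠ 0 :=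
  qPoch_ne_zero (one_sub_mul_pow_ne_zero hq hq) n

theorem qPoch_self_succ (q : ℂ) (n : ℕ) :
    qPoch q q (n + 1) = qPoch q q n * (1 - q ^ (n + 1)) := by
  rw [qPoch, qPoch, prod_range_succ, pow_succ']

/-- Euler's power series `∑ X ^ n / (q; q)_n`. -/
noncomputable def eulerSeries (q : ℂ) : PowerSeries ℂ :=
  PowerSeries.mk fun n => 1 / qPoch q q n

theorem rescale_eulerSeries {q : ℂ} (hq : ‖q‖ < 1) :
    PowerSeries.rescale q (eulerSeries q) = (1 - PowerSeries.X) * eulerSeries q := by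
  ext n
  rw [PowerSeries.coeff_rescale, sub_mul, one_mul, map_sub]
  cases n with
  | zero => simp
  | succ n =>
    have h1 := qPoch_self_ne_zero hq n
    have h2 := qPoch_self_ne_zero hq (n + 1)
    rw [PowerSeries.coeff_succ_X_mul]
    simp only [eulerSeries, PowerSeries.coeff_mk]
    rw [qPoch_self_succ] at h2 ⊢
    have h3 := right_ne_zero_of_mul h2
    field_simp
    ring

/-- The functional equation says `c_{n+1} (1 - q^{n+1}) = c_n` for the coefficients, so the constant
term determines them all. This stands in for the product formula `1 / (x; q)_∞` and needs no
convergence. -/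
theorem eq_eulerSeries {q : ℂ} (hq : ‖q‖ < 1) {f : PowerSeries ℂ}
    (h0 : PowerSeries.coeff 0 f = 1)
    (hf : PowerSeries.rescale q f = (1 - PowerSeries.X) * f) : f = eulerSeries q := by
  ext n
  induction n with
  | zero => simp [h0, eulerSeries, qPoch]
  | succ n ih =>
    have h := congrArg (PowerSeries.coeff (n + 1)) hf
    have h2 := qPoch_self_ne_zero hq (n + 1)
    rw [PowerSeries.coeff_rescale, sub_mul, one_mul, map_sub, PowerSeries.coeff_succ_X_mul, ih] at h
    simp only [eulerSeries, PowerSeries.coeff_mk] at h ⊢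
    rw [qPoch_self_succ] at h2 ⊢
    have h3 := right_ne_zero_of_mul h2
    have h4 := left_ne_zero_of_mul h2
    field_simp at h ⊢
    linear_combination -h

/-- Rescaling by `q` turns the factors `E(x) E(qx)` into `E(qx) E(q²x)`, and `E(q²x) = (1 - x)
E(x)`; thus the product satisfies the equation characterizing `eulerSeries q`. -/
theorem eulerSeries_mul_rescale {q : ℂ} (hq : ‖q‖ < 1) :
    eulerSeries (q ^ 2) * PowerSeries.rescale q (eulerSeries (q ^ 2)) = eulerSeries q := by
  have hq2 : ‖q ^ 2‖ < 1 := by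
    rw [norm_pow]; exact pow_lt_one₀ (norm_nonneg q) hq two_ne_zero
  refine eq_eulerSeries hq (by simp [eulerSeries, qPoch, PowerSeries.coeff_mul, PowerSeries.coeff_rescale]) ?_
  rw [map_mul, PowerSeries.rescale_rescale, ← sq, rescale_eulerSeries hq2]
  ring

theorem sum_antidiagonal_pow_div_qPoch {q : ℂ} (hq : ‖q‖ < 1) (m : ℕ) :
    ∑ x ∈ antidiagonal m, q ^ x.2 / (qPoch (q ^ 2) (q ^ 2) x.1 * qPoch (q ^ 2) (q ^ 2) x.2) =
      1 / qPoch q q m := by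
  have h := congrArg (PowerSeries.coeff m) (eulerSeries_mul_rescale hq)
  rw [PowerSeries.coeff_mul] at h
  simp only [PowerSeries.coeff_rescale, eulerSeries, PowerSeries.coeff_mk] at h
  rw [← h]
  refine sum_congr rfl fun x _ => ?_
  rw [div_mul_eq_div_div, one_div_mul_eq_div, mul_one_div, div_right_comm]

/-! ### The Bailey pair -/

theorem sum_Icc_neg_succ {M : Type*} [AddCommMonoid M] (s : ℤ → M) (n : ℕ) :
    ∑ j ∈ Icc (-((n + 1 : ℕ) : ℤ)) ((n + 1 : ℕ) : ℤ), s j =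
      ∑ j ∈ Icc (-(n : ℤ)) n, s j + (s (n + 1) + s (-(n + 1))) := by
  have : Icc (-((n + 1 : ℕ) : ℤ)) ((n + 1 : ℕ) : ℤ) =
      insert (-(n + 1 : ℤ)) (insert (n + 1 : ℤ) (Icc (-(n : ℤ)) n)) := by
    ext j; simp only [mem_insert, mem_Icc]; push_cast; omega
  rw [this, sum_insert, sum_insert]
  · abel
  · simp
  · simp only [mem_insert, mem_Icc]; omega

/-- Abel summation: a given `j` occurs for `|j| ≤ r < N`, and the differences of `h` telescope over
that range. -/
theorem sum_range_sub_mul_sum_Icc {R : Type*} [CommRing R] (h : ℕ → R) (s : ℤ → R) (N : ℕ) :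
    ∑ r ∈ range N, (h r - h (r + 1)) * ∑ j ∈ Icc (-(r : ℤ)) r, s j =
      ∑ j ∈ Icc (-(N : ℤ)) N, (h j.natAbs - h N) * s j := by
  induction N with
  | zero => simp
  | succ N ih =>
    have h1 : ((N : ℤ) + 1).natAbs = N + 1 := by omega
    have h2 : (-((N : ℤ) + 1)).natAbs = N + 1 := by omega
    rw [sum_range_succ, ih, sum_Icc_neg_succ, h1, h2, sub_self, zero_mul, zero_mul, add_zero,
      add_zero, mul_sum, ← sum_add_distrib]
    exact sum_congr rfl fun j _ => by ring

/-- The sequence `α` of the Bailey pair relative to `q ^ 2` in base `q ^ 2`, up to normalization. -/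
noncomputable def baileyAlpha (q : ℂ) (r : ℕ) : ℂ :=
  ∑ j ∈ Icc (-(r : ℤ)) (r : ℤ), (1 - q ^ (4 * r + 2)) * q ^ (2 * (r : ℤ) ^ 2 - 2 * j ^ 2 - j)

theorem baileyAlpha_eq {q : ℂ} (hq0 : q ≠ 0) (r : ℕ) :
    baileyAlpha q r = (1 - q ^ (4 * r + 2)) * q ^ (2 * r ^ 2) *
      ∑ j ∈ Icc (-(r : ℤ)) (r : ℤ), q ^ (-2 * j ^ 2 - j) := by
  rw [baileyAlpha, mul_sum]
  refine sum_congr rfl fun j _ => ?_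
  rw [mul_assoc, ← zpow_natCast q (2 * r ^ 2), ← zpow_add₀ hq0]
  congr 2
  push_cast
  ring

/-- `q ^ (2 * r ^ 2) / ((q ^ 2; q ^ 2)_{n - r} (q ^ 2; q ^ 2)_{n + r})`, zero for `n < r`. -/
noncomputable def baileyKernel (q : ℂ) (n r : ℕ) : ℂ :=
  if r ≤ n then q ^ (2 * r ^ 2) / (qPoch (q ^ 2) (q ^ 2) (n - r) * qPoch (q ^ 2) (q ^ 2) (n + r))
  else 0

/-- Over the common denominator this is `(1 - p^{2r+m+1}) - q^{4r+2} (1 - p^m) = 1 - q^{4r+2}` with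
`p = q ^ 2`. For `m = 0` the second kernel is zero by convention, matching the factor `1 - p^0`. -/
theorem baileyKernel_sub {q : ℂ} (hq : ‖q‖ < 1) (r m : ℕ) :
    baileyKernel q (r + m) r - baileyKernel q (r + m) (r + 1) =
      (1 - q ^ (4 * r + 2)) * q ^ (2 * r ^ 2) /
        (qPoch (q ^ 2) (q ^ 2) m * qPoch (q ^ 2) (q ^ 2) (2 * r + 1 + m)) := by
  have hq2 : ‖q ^ 2‖ < 1 := by
    rw [norm_pow]; exact pow_lt_one₀ (norm_nonneg q) hq two_ne_zero
  have e1 : r + m + r = 2 * r + m := by ring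
  have e2 : 2 * r + 1 + m = 2 * r + m + 1 := by ring
  have h1 := qPoch_self_ne_zero hq2 (2 * r + m)
  have h2 := qPoch_self_ne_zero hq2 (2 * r + m + 1)
  have h3 := qPoch_self_ne_zero hq2 m
  rw [baileyKernel, if_pos (by omega), Nat.add_sub_cancel_left, e1, e2]
  cases m with
  | zero =>
    rw [baileyKernel, if_neg (by omega), qPoch_self_succ] at *
    have h4 := right_ne_zero_of_mul h2
    simp only [add_zero] at *
    field_simp
    ring
  | succ m =>
    have e3 : r + (m + 1) - (r + 1) = m := by omega
    have e4 : r + (m + 1) + (r + 1) = 2 * r + (m + 1) + 1 := by ring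
    rw [baileyKernel, if_pos (by omega), e3, e4]
    rw [qPoch_self_succ] at h2 h3
    rw [qPoch_self_succ _ (2 * r + (m + 1)), qPoch_self_succ _ m]
    have h4 := right_ne_zero_of_mul h2
    have h5 := right_ne_zero_of_mul h3
    have h6 := left_ne_zero_of_mul h3
    field_simp
    ring

theorem sum_baileyKernel {q : ℂ} (hq0 : q ≠ 0) (hq : ‖q‖ < 1) (n : ℕ) :
    ∑ j ∈ Icc (-(n : ℤ)) n, baileyKernel q n j.natAbs * q ^ (-2 * j ^ 2 - j) =
      (1 / q) ^ n / qPoch q q (2 * n) := by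
  rw [← mul_one_div, ← sum_antidiagonal_pow_div_qPoch hq, mul_sum]
  symm
  -- Substituting `i = n + j`, `k = n - j`, the quadratic exponents cancel and `q^{-j} = q^{-n} q^k`
  -- remains.
  refine sum_nbij' (fun x => (n : ℤ) - x.2) (fun j => ((n + j).toNat, (n - j).toNat))
    ?_ ?_ ?_ ?_ ?_
  · intro x hx; simp only [HasAntidiagonal.mem_antidiagonal, mem_Icc] at *; omega
  · intro j hj; simp only [HasAntidiagonal.mem_antidiagonal, mem_Icc] at *; omega
  · intro x hx; simp only [HasAntidiagonal.mem_antidiagonal] at *; ext <;> simp only <;> omega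
  · intro j hj; simp only [mem_Icc] at *; omega
  · rintro ⟨i, k⟩ hx
    simp only [HasAntidiagonal.mem_antidiagonal] at hx ⊢
    have hab : ((n : ℤ) - k).natAbs ≤ n := by omega
    have hp : q ^ (2 * ((n : ℤ) - k).natAbs ^ 2) * q ^ (-2 * ((n : ℤ) - k) ^ 2 - ((n : ℤ) - k)) =
        (1 / q) ^ n * q ^ k := by
      rw [one_div, inv_pow, ← zpow_natCast, ← zpow_natCast, ← zpow_natCast, ← zpow_neg,
        ← zpow_add₀ hq0, ← zpow_add₀ hq0]
      congr 1
      push_cast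
      rw [sq_abs]
      ring
    rw [baileyKernel, if_pos hab, div_mul_eq_mul_div, hp, mul_div_assoc]
    congr 2
    rcases le_total k n with hk | hk
    · rw [show n - ((n : ℤ) - k).natAbs = k by omega, show n + ((n : ℤ) - k).natAbs = i by omega,
        mul_comm]
    · rw [show n - ((n : ℤ) - k).natAbs = i by omega, show n + ((n : ℤ) - k).natAbs = k by omega]

theorem sum_antidiagonal_baileyAlpha {q : ℂ} (hq0 : q ≠ 0) (hq : ‖q‖ < 1) (n : ℕ) :
    ∑ x ∈ antidiagonal n, baileyAlpha q x.1 /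
        (qPoch (q ^ 2) (q ^ 2) x.2 * qPoch (q ^ 2) (q ^ 2) (2 * x.1 + 1 + x.2)) =
      (1 / q) ^ n / qPoch q q (2 * n) := by
  have h0 : baileyKernel q n (n + 1) = 0 := if_neg (by omega)
  -- Taking `N = n + 1`, where the kernel vanishes, removes both the boundary value and the terms `j
  -- = ±(n + 1)`.
  have h := sum_range_sub_mul_sum_Icc (baileyKernel q n) (fun j => q ^ (-2 * j ^ 2 - j)) (n + 1)
  rw [sum_Icc_neg_succ] at h
  have h1 : ((n : ℤ) + 1).natAbs = n + 1 := by omega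
  have h2 : (-((n : ℤ) + 1)).natAbs = n + 1 := by omega
  simp only [h0, h1, h2, sub_zero, zero_mul, add_zero] at h
  rw [← sum_baileyKernel hq0 hq, ← h, Nat.sum_antidiagonal_eq_sum_range_succ_mk]
  refine sum_congr rfl fun r hr => ?_
  obtain ⟨m, rfl⟩ := Nat.exists_eq_add_of_le (Nat.lt_succ_iff.1 (mem_range.1 hr))
  rw [Nat.add_sub_cancel_left, baileyKernel_sub hq, baileyAlpha_eq hq0]
  ring

/-! ### Bounds and summation over antidiagonals -/

theorem qPochDivMulPow_add (x a p : ℂ) (m n : ℕ) :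
    qPochDivMulPow x a p (m + n) = qPochDivMulPow x a p m * qPochDivMulPow (x * p ^ m) a p n := by
  simp only [qPochDivMulPow, prod_range_add, pow_add, mul_assoc]

theorem norm_baileyAlpha_le {q : ℝ} (hq0 : 0 < q) (hq1 : q < 1) (r : ℕ) :
    ‖baileyAlpha q r‖ ≤ (2 * r + 1) * (1 / q) ^ r := by
  refine (norm_sum_le _ _).trans ?_
  have hc : ((Icc (-(r : ℤ)) (r : ℤ)).card : ℝ) = 2 * r + 1 := by
    have : (Icc (-(r : ℤ)) (r : ℤ)).card = 2 * r + 1 := by rw [Int.card_Icc]; omega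
    rw [this]; push_cast; ring
  rw [← hc, ← nsmul_eq_mul]
  refine sum_le_card_nsmul _ _ _ fun j hj => ?_
  rw [mem_Icc] at hj
  have h1 : ((1 : ℂ) - (q : ℂ) ^ (4 * r + 2)) = (1 - q ^ (4 * r + 2) : ℝ) := by push_cast; ring
  have h2 : q ^ (4 * r + 2) ≤ 1 := pow_le_one₀ hq0.le hq1.le
  have h3 : 0 < q ^ (4 * r + 2) := pow_pos hq0 _
  rw [norm_mul, h1, Complex.norm_real, Real.norm_of_nonneg (by linarith), norm_zpow,
    Complex.norm_real, Real.norm_of_nonneg hq0.le]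
  -- The exponent plus `r` equals `(r - j) (2 (r + j) + 1)`, which is nonnegative for `|j| ≤ r`.
  have h4 : q ^ (2 * (r : ℤ) ^ 2 - 2 * j ^ 2 - j) ≤ q ^ (-(r : ℤ)) := by
    refine zpow_le_zpow_right_of_le_one₀ hq0 hq1.le ?_
    nlinarith [mul_nonneg (sub_nonneg.2 hj.2) (by linarith : (0 : ℤ) ≤ r + j)]
  rw [zpow_neg, zpow_natCast, ← inv_pow, ← one_div] at h4
  exact (mul_le_of_le_one_left (by positivity) (by linarith)).trans h4

theorem exists_norm_inv_qPoch_le {q : ℂ} (hq : ‖q‖ < 1) :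
    ∃ K : ℝ, 0 < K ∧ ∀ n, ‖(qPoch q q n)⁻¹‖ ≤ K := by
  have h := ((tendsto_qPoch q q hq).inv₀
    (qPochInf_ne_zero hq (one_sub_mul_pow_ne_zero hq hq))).norm.bddAbove_range
  obtain ⟨K, hK⟩ := h
  exact ⟨max K 1, by positivity, fun n => (hK ⟨n, rfl⟩).trans (le_max_left _ _)⟩

theorem summable_prod_of_add {w : ℕ → ℝ} (hw0 : ∀ n, 0 ≤ w n)
    (hw : Summable fun n : ℕ => ((n : ℝ) + 1) * w n) :
    Summable fun x : ℕ × ℕ => w (x.1 + x.2) := by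
  rw [← HasAntidiagonal.sigmaAntidiagonalEquivProd.summable_iff]
  refine (summable_sigma_of_nonneg fun _ => hw0 _).2 ?_
  refine ⟨fun n => (hasSum_fintype _).summable, hw.congr fun n => ?_⟩
  rw [tsum_fintype]
  have : ∀ x : antidiagonal n, ((fun x : ℕ × ℕ => w (x.1 + x.2)) ∘
      HasAntidiagonal.sigmaAntidiagonalEquivProd) ⟨n, x⟩ = w n := fun x => by
    have := HasAntidiagonal.mem_antidiagonal.1 x.2
    simp [this]
  calc _ = ∑ _x : antidiagonal n, w n := by simp
    _ = _ := (sum_congr rfl fun x _ => this x).symm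

theorem hasSum_antidiagonal {f : ℕ × ℕ → ℂ} {s : ℂ} (h : HasSum f s) :
    HasSum (fun n => ∑ x ∈ antidiagonal n, f x) s := by
  rw [← HasAntidiagonal.sigmaAntidiagonalEquivProd.hasSum_iff] at h
  refine h.sigma fun n => ?_
  rw [← sum_coe_sort]
  exact hasSum_fintype _

/-! ### The double series and the general transformation -/

section Transformation

variable {q : ℝ} (hq0 : 0 < q) (hq1 : q < 1) (a b : ℂ)

/-- The product `(q ^ 2 / a, q ^ 2 / b; q ^ 2)_n (a b) ^ n`, as a polynomial in `a` and `b`. -/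
noncomputable def transTerm (q a b : ℂ) (n : ℕ) : ℂ :=
  qPochDivMulPow (q ^ 2) a (q ^ 2) n * qPochDivMulPow (q ^ 2) b (q ^ 2) n

include hq0 hq1 in
-- Of the two factors `n + 1`, one pays for the number of `j` in `baileyAlpha` and one for the
-- points of an antidiagonal; `(1 / q) ^ n` absorbs the growth of `baileyAlpha`.
theorem summable_sq_mul_norm_transTerm (hab : ‖a * b / (q : ℂ)‖ < 1) :
    Summable fun n : ℕ => ((n : ℝ) + 1) ^ 2 * ((1 / q) ^ n * ‖transTerm q a b n‖) := by
  have h : Tendsto (fun k : ℕ => (q : ℂ) ^ 2 * ((q : ℂ) ^ 2) ^ k) atTop (𝓝 0) := by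
    have := (tendsto_ofReal_pow_zero (pow_pos hq0 2) (pow_lt_one₀ hq0.le hq1 two_ne_zero)).const_mul
      ((q : ℂ) ^ 2)
    simpa using this
  have hc : Tendsto (fun k : ℕ => ‖(a - (q : ℂ) ^ 2 * ((q : ℂ) ^ 2) ^ k) *
      (b - (q : ℂ) ^ 2 * ((q : ℂ) ^ 2) ^ k) / q‖) atTop (𝓝 ‖a * b / (q : ℂ)‖) := by
    simpa using (((h.const_sub a).mul (h.const_sub b)).div_const (q : ℂ)).norm
  refine (summable_sq_mul_norm_prod hc hab).congr fun n => ?_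
  rw [prod_div_distrib, prod_mul_distrib, prod_const, card_range, norm_div, norm_pow,
    Complex.norm_real, Real.norm_of_nonneg hq0.le, transTerm, qPochDivMulPow, qPochDivMulPow,
    one_div, inv_pow, div_eq_inv_mul]

/-- The summand of the double series that is evaluated in two ways. -/
noncomputable def doubleTerm (q a b : ℂ) (x : ℕ × ℕ) : ℂ :=
  transTerm q a b (x.1 + x.2) * (baileyAlpha q x.1 /
    (qPoch (q ^ 2) (q ^ 2) x.2 * qPoch (q ^ 2) (q ^ 2) (2 * x.1 + 1 + x.2)))

include hq0 hq1 in
theorem summable_doubleTerm (hab : ‖a * b / (q : ℂ)‖ < 1) : Summable (doubleTerm q a b) := by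
  have hq2 : ‖(q : ℂ) ^ 2‖ < 1 := by
    rw [norm_pow, Complex.norm_real, Real.norm_of_nonneg hq0.le]
    exact pow_lt_one₀ hq0.le hq1 two_ne_zero
  obtain ⟨K, hK0, hK⟩ := exists_norm_inv_qPoch_le hq2
  have h1 := summable_prod_of_add
    (w := fun n => ((n : ℝ) + 1) * ((1 / q) ^ n * ‖transTerm q a b n‖))
    (fun n => by positivity)
    ((summable_sq_mul_norm_transTerm hq0 hq1 a b hab).congr fun n => by ring)
  refine (h1.mul_left (2 * K * K)).of_norm_bounded fun x => ?_
  obtain ⟨r, m⟩ := x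
  have hA := norm_baileyAlpha_le hq0 hq1 r
  have hq1' : 1 ≤ 1 / q := (one_le_div hq0).2 hq1.le
  have hA' : ‖baileyAlpha q r‖ ≤ 2 * (((r + m : ℕ) : ℝ) + 1) * (1 / q) ^ (r + m) := by
    refine hA.trans (mul_le_mul ?_ (pow_le_pow_right₀ hq1' (by omega)) (by positivity)
      (by positivity))
    push_cast
    linarith [(Nat.cast_nonneg m : (0 : ℝ) ≤ m), (Nat.cast_nonneg r : (0 : ℝ) ≤ r)]
  rw [doubleTerm, div_eq_mul_inv, mul_inv, norm_mul, norm_mul, norm_mul]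
  calc _ ≤ ‖transTerm q a b (r + m)‖ *
        (2 * (((r + m : ℕ) : ℝ) + 1) * (1 / q) ^ (r + m) * (K * K)) := by
        gcongr
        · exact hK _
        · exact hK _
    _ = _ := by ring

theorem qPochDivMulPow_scale (x c : ℂ) (p y : ℂ) (n : ℕ) :
    ∏ k ∈ range n, (y * c - y * x * p ^ k) = y ^ n * qPochDivMulPow x c p n := by
  rw [qPochDivMulPow, ← card_range n, ← prod_const, card_range, ← prod_mul_distrib]
  exact prod_congr rfl fun k _ => by ring

include hq0 hq1 in
-- Identifies the row `r` of the double series as `q`-Gauss terms with `C = p^{2r+2}`, `u = a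
-- p^{r+1}`, `v = b p^{r+1}`, where `p = q ^ 2`; then `u v / C = a b` for every `r`.
theorem gaussTerm_transTerm (r m : ℕ) :
    transTerm q a b r * gaussTerm (q ^ 2) ((q ^ 2) ^ (2 * r + 2))
      ((q : ℂ) ^ 2 * a * ((q : ℂ) ^ 2) ^ r) ((q : ℂ) ^ 2 * b * ((q : ℂ) ^ 2) ^ r) m *
      (qPoch ((q : ℂ) ^ 2) ((q : ℂ) ^ 2) m *
        qPoch ((q : ℂ) ^ 2) ((q : ℂ) ^ 2) (2 * r + 1 + m)) =
      transTerm q a b (r + m) * qPoch ((q : ℂ) ^ 2) ((q : ℂ) ^ 2) (2 * r + 1) := by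
  have hp0 : 0 < q ^ 2 := pow_pos hq0 2
  have hp1 : q ^ 2 < 1 := pow_lt_one₀ hq0.le hq1 two_ne_zero
  have hp : ‖(q : ℂ) ^ 2‖ < 1 := by simpa [abs_of_pos hq0] using hp1
  have hC1 : (q ^ 2) ^ (2 * r + 2) < 1 := pow_lt_one₀ hp0.le hp1 (by omega)
  have hC0 : 0 < (q ^ 2) ^ (2 * r + 2) := pow_pos hp0 _
  have hq : (q : ℂ) ≠ 0 := by exact_mod_cast hq0.ne'
  set p : ℂ := (q : ℂ) ^ 2 with hpdef
  have hpne : p ≠ 0 := pow_ne_zero _ hq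
  have hcast : (((q ^ 2) ^ (2 * r + 2) : ℝ) : ℂ) = p ^ (2 * r + 2) := by push_cast; rfl
  have hcast' : ((q ^ 2 : ℝ) : ℂ) = p := by push_cast; rfl
  have hu : ∀ c : ℂ, ∏ k ∈ range m, (p * c * p ^ r - p ^ (2 * r + 2) * p ^ k) =
      (p ^ (r + 1)) ^ m * qPochDivMulPow (p * p ^ r) c p m := fun c => by
    rw [← qPochDivMulPow_scale]
    exact prod_congr rfl fun k _ => by ring
  have hden : ∏ k ∈ range m, (1 - p ^ (k + 1)) = qPoch p p m := by
    simp only [qPoch, pow_succ']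
  have hden' : ∏ k ∈ range m, (1 - p ^ (2 * r + 2) * p ^ k) =
      qPoch (p * p ^ (2 * r + 1)) p m := by
    rw [qPoch]; exact prod_congr rfl fun k _ => by ring
  have hne1 := qPoch_self_ne_zero hp m
  have hne2 := qPoch_self_ne_zero hp (2 * r + 1 + m)
  rw [qPoch_add] at hne2
  have hne3 := right_ne_zero_of_mul hne2
  rw [gaussTerm, hcast, hcast', prod_div_distrib, prod_mul_distrib, prod_mul_distrib,
    prod_mul_distrib, hu, hu, hden, hden', prod_const, card_range, qPoch_add, transTerm, transTerm,
    ← hpdef, qPochDivMulPow_add, qPochDivMulPow_add]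
  have hpp : (p ^ (2 * r + 2)) ^ m = (p ^ (r + 1)) ^ m * (p ^ (r + 1)) ^ m := by
    rw [← mul_pow]; congr 1; ring
  rw [hpp]
  field_simp

include hq0 hq1 in
theorem hasSum_doubleTerm_fiber (hab : ‖a * b / (q : ℂ)‖ < 1)
    (ha : ∀ k : ℕ, 1 - (q : ℂ) ^ 2 * a * ((q : ℂ) ^ 2) ^ k ≠ 0)
    (hb : ∀ k : ℕ, 1 - (q : ℂ) ^ 2 * b * ((q : ℂ) ^ 2) ^ k ≠ 0) (r : ℕ) :
    HasSum (fun m => doubleTerm q a b (r, m))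
      (qPochInf ((q : ℂ) ^ 2 * a) ((q : ℂ) ^ 2) * qPochInf ((q : ℂ) ^ 2 * b) ((q : ℂ) ^ 2) /
        (qPochInf ((q : ℂ) ^ 2) ((q : ℂ) ^ 2) * qPochInf (a * b) ((q : ℂ) ^ 2)) *
        (baileyAlpha q r * transTerm q a b r /
          (qPoch ((q : ℂ) ^ 2 * a) ((q : ℂ) ^ 2) r *
            qPoch ((q : ℂ) ^ 2 * b) ((q : ℂ) ^ 2) r))) := by
  have hp0 : 0 < q ^ 2 := pow_pos hq0 2
  have hp1 : q ^ 2 < 1 := pow_lt_one₀ hq0.le hq1 two_ne_zero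
  have hp : ‖(q : ℂ) ^ 2‖ < 1 := by simpa [abs_of_pos hq0] using hp1
  have hC1 : (q ^ 2) ^ (2 * r + 2) < 1 := pow_lt_one₀ hp0.le hp1 (by omega)
  have hC0 : 0 < (q ^ 2) ^ (2 * r + 2) := pow_pos hp0 _
  have hq : (q : ℂ) ≠ 0 := by exact_mod_cast hq0.ne'
  have hab1 : ‖a * b‖ < 1 := by
    rw [norm_div, Complex.norm_real, Real.norm_of_nonneg hq0.le, div_lt_one hq0] at hab
    exact hab.trans hq1
  have huv : (q : ℂ) ^ 2 * a * ((q : ℂ) ^ 2) ^ r * ((q : ℂ) ^ 2 * b * ((q : ℂ) ^ 2) ^ r) /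
      ((q ^ 2) ^ (2 * r + 2) : ℝ) = a * b := by
    push_cast
    field_simp
    ring
  have hs := summable_norm_gaussTerm hp0 hp1 hC0 ((q : ℂ) ^ 2 * a * ((q : ℂ) ^ 2) ^ r)
    ((q : ℂ) ^ 2 * b * ((q : ℂ) ^ 2) ^ r) (by rwa [huv])
  have ht := tsum_gaussTerm hp0 hp1 hC0 hC1 ((q : ℂ) ^ 2 * a * ((q : ℂ) ^ 2) ^ r)
    ((q : ℂ) ^ 2 * b * ((q : ℂ) ^ 2) ^ r) (by rwa [huv])
  have hkey := gaussTerm_transTerm hq0 hq1 a b r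
  rw [huv] at ht
  have e1 := qPochInf_eq_mul (n := r) (hp := hp) (a := (q : ℂ) ^ 2 * a)
  have e2 := qPochInf_eq_mul (n := r) (hp := hp) (a := (q : ℂ) ^ 2 * b)
  have e3 := qPochInf_eq_mul (n := 2 * r + 1) (hp := hp) (a := (q : ℂ) ^ 2)
  have hC : (((q ^ 2) ^ (2 * r + 2) : ℝ) : ℂ) = (q : ℂ) ^ 2 * ((q : ℂ) ^ 2) ^ (2 * r + 1) := by
    push_cast; ring
  rw [hC] at ht
  push_cast at ht
  have n1 := qPochInf_ne_zero hp (one_sub_mul_pow_ne_zero hp hp)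
  have n2 := qPochInf_ne_zero hp (one_sub_mul_pow_ne_zero hab1 hp)
  have n3 := qPoch_ne_zero ha r
  have n4 := qPoch_ne_zero hb r
  have n5 := qPoch_self_ne_zero hp (2 * r + 1)
  have n6 : qPochInf ((q : ℂ) ^ 2 * ((q : ℂ) ^ 2) ^ (2 * r + 1)) ((q : ℂ) ^ 2) ≠ 0 := by
    rw [e3] at n1; exact right_ne_zero_of_mul n1
  have := hs.of_norm.hasSum.mul_left (baileyAlpha q r * transTerm q a b r /
    qPoch ((q : ℂ) ^ 2) ((q : ℂ) ^ 2) (2 * r + 1))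
  have hval : qPochInf ((q : ℂ) ^ 2 * a) ((q : ℂ) ^ 2) * qPochInf ((q : ℂ) ^ 2 * b) ((q : ℂ) ^ 2) /
        (qPochInf ((q : ℂ) ^ 2) ((q : ℂ) ^ 2) * qPochInf (a * b) ((q : ℂ) ^ 2)) *
        (baileyAlpha q r * transTerm q a b r /
          (qPoch ((q : ℂ) ^ 2 * a) ((q : ℂ) ^ 2) r * qPoch ((q : ℂ) ^ 2 * b) ((q : ℂ) ^ 2) r)) =
      baileyAlpha q r * transTerm q a b r / qPoch ((q : ℂ) ^ 2) ((q : ℂ) ^ 2) (2 * r + 1) *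
        ∑' n, gaussTerm (q ^ 2) ((q ^ 2) ^ (2 * r + 2))
          ((q : ℂ) ^ 2 * a * ((q : ℂ) ^ 2) ^ r) ((q : ℂ) ^ 2 * b * ((q : ℂ) ^ 2) ^ r) n := by
    -- Splitting off the first `r`, `r` and `2r + 1` factors leaves exactly the shifted infinite
    -- products of the `q`-Gauss sum.
    rw [e1, e2, e3]
    generalize ∑' n, gaussTerm (q ^ 2) ((q ^ 2) ^ (2 * r + 2))
      ((q : ℂ) ^ 2 * a * ((q : ℂ) ^ 2) ^ r) ((q : ℂ) ^ 2 * b * ((q : ℂ) ^ 2) ^ r) n = T at ht ⊢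
    generalize (q : ℂ) ^ 2 * b * ((q : ℂ) ^ 2) ^ r = v at ht ⊢
    field_simp
    linear_combination -baileyAlpha q r * transTerm q a b r * ht
  rw [hval]
  refine this.congr_fun fun m => ?_
  have n7 := qPoch_self_ne_zero hp m
  have n8 := qPoch_self_ne_zero hp (2 * r + 1 + m)
  have := hkey m
  rw [doubleTerm]
  generalize (q : ℂ) ^ 2 * b * ((q : ℂ) ^ 2) ^ r = v at this ⊢
  field_simp
  linear_combination -baileyAlpha q r * this

include hq0 hq1 in
theorem sum_antidiagonal_doubleTerm (n : ℕ) :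
    ∑ x ∈ antidiagonal n, doubleTerm q a b x =
      transTerm q a b n * (1 / (q : ℂ)) ^ n / qPoch q q (2 * n) := by
  have hq : ‖(q : ℂ)‖ < 1 := by simpa [abs_of_pos hq0] using hq1
  rw [mul_div_assoc, ← sum_antidiagonal_baileyAlpha (by exact_mod_cast hq0.ne') hq, mul_sum]
  refine sum_congr rfl fun x hx => ?_
  rw [doubleTerm, HasAntidiagonal.mem_antidiagonal.1 hx]

include hq0 hq1 in
theorem transformation (hab : ‖a * b / (q : ℂ)‖ < 1)
    (ha : ∀ k : ℕ, 1 - (q : ℂ) ^ 2 * a * ((q : ℂ) ^ 2) ^ k ≠ 0)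
    (hb : ∀ k : ℕ, 1 - (q : ℂ) ^ 2 * b * ((q : ℂ) ^ 2) ^ k ≠ 0) :
    (Summable fun n => transTerm q a b n * (1 / (q : ℂ)) ^ n / qPoch q q (2 * n)) ∧
    HasSum (fun n => baileyAlpha q n * transTerm q a b n /
        (qPoch ((q : ℂ) ^ 2 * a) ((q : ℂ) ^ 2) n * qPoch ((q : ℂ) ^ 2 * b) ((q : ℂ) ^ 2) n))
      (qPochInf ((q : ℂ) ^ 2) ((q : ℂ) ^ 2) * qPochInf (a * b) ((q : ℂ) ^ 2) /
          (qPochInf ((q : ℂ) ^ 2 * a) ((q : ℂ) ^ 2) * qPochInf ((q : ℂ) ^ 2 * b) ((q : ℂ) ^ 2)) *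
        ∑' n, transTerm q a b n * (1 / (q : ℂ)) ^ n / qPoch q q (2 * n)) := by
  have hp1 : q ^ 2 < 1 := pow_lt_one₀ hq0.le hq1 two_ne_zero
  have hp : ‖(q : ℂ) ^ 2‖ < 1 := by simpa [abs_of_pos hq0] using hp1
  have hab1 : ‖a * b‖ < 1 := by
    rw [norm_div, Complex.norm_real, Real.norm_of_nonneg hq0.le, div_lt_one hq0] at hab
    exact hab.trans hq1
  have hs := (summable_doubleTerm hq0 hq1 a b hab).hasSum
  have h1 := hasSum_antidiagonal hs
  simp only [sum_antidiagonal_doubleTerm hq0 hq1] at h1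
  refine ⟨h1.summable, ?_⟩
  rw [h1.tsum_eq]
  -- The same double sum by rows; the constant is the inverse of the `r`-independent factor in every
  -- row sum.
  have h2 := (hs.prod_fiberwise (hasSum_doubleTerm_fiber hq0 hq1 a b hab ha hb)).mul_left
    (qPochInf ((q : ℂ) ^ 2) ((q : ℂ) ^ 2) * qPochInf (a * b) ((q : ℂ) ^ 2) /
      (qPochInf ((q : ℂ) ^ 2 * a) ((q : ℂ) ^ 2) * qPochInf ((q : ℂ) ^ 2 * b) ((q : ℂ) ^ 2)))
  refine h2.congr_fun fun n => ?_
  have n1 := qPochInf_ne_zero hp (one_sub_mul_pow_ne_zero hp hp)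
  have n2 := qPochInf_ne_zero hp (one_sub_mul_pow_ne_zero hab1 hp)
  have n3 := qPochInf_ne_zero hp ha
  have n4 := qPochInf_ne_zero hp hb
  rw [← mul_assoc, div_mul_div_cancel₀ (mul_ne_zero n3 n4), div_self (mul_ne_zero n1 n2), one_mul]

end Transformation

/-! ### The three special cases -/

theorem qPoch_zero_left (p : ℂ) (n : ℕ) : qPoch 0 p n = 1 := by simp [qPoch]

theorem qPochInf_zero_left (p : ℂ) : qPochInf 0 p = 1 := by simp [qPochInf]

theorem qPochDivMulPow_sq_zero (q : ℂ) (n : ℕ) :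
    qPochDivMulPow (q ^ 2) 0 (q ^ 2) n = (-1) ^ n * q ^ (n ^ 2 + n) := by
  induction n with
  | zero => simp [qPochDivMulPow]
  | succ n ih =>
    rw [qPochDivMulPow] at ih ⊢
    rw [prod_range_succ, ih]
    ring

theorem qPochDivMulPow_one (x p : ℂ) (n : ℕ) : qPochDivMulPow x 1 p n = qPoch x p n := rfl

theorem qPoch_two_mul (q : ℂ) (n : ℕ) :
    qPoch q q (2 * n) = qPoch q (q ^ 2) n * qPoch (q ^ 2) (q ^ 2) n := by
  induction n with
  | zero => simp [qPoch]
  | succ n ih =>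
    rw [Nat.mul_succ, qPoch_self_succ, qPoch_self_succ, ih]
    rw [qPoch, qPoch, qPoch, qPoch, prod_range_succ, prod_range_succ]
    ring

theorem qPoch_mul_neg (a p : ℂ) (n : ℕ) :
    qPoch a p n * qPoch (-a) p n = qPoch (a ^ 2) (p ^ 2) n := by
  simp only [qPoch, ← prod_mul_distrib]
  exact prod_congr rfl fun k _ => by ring

theorem norm_sq_lt_one {p : ℂ} (hp : ‖p‖ < 1) : ‖p ^ 2‖ < 1 := by
  rw [norm_pow]; exact pow_lt_one₀ (norm_nonneg p) hp two_ne_zero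

theorem qPochInf_mul_neg (a : ℂ) {p : ℂ} (hp : ‖p‖ < 1) :
    qPochInf a p * qPochInf (-a) p = qPochInf (a ^ 2) (p ^ 2) := by
  refine tendsto_nhds_unique ((tendsto_qPoch a p hp).mul (tendsto_qPoch (-a) p hp)) ?_
  simp only [qPoch_mul_neg]
  exact tendsto_qPoch _ _ (norm_sq_lt_one hp)

theorem transTerm_self_neg (q : ℂ) (n : ℕ) :
    transTerm q q (-q) n = (-q ^ 2) ^ n * qPoch (q ^ 2) (q ^ 4) n := by
  rw [transTerm, qPochDivMulPow, qPochDivMulPow, qPoch, ← prod_mul_distrib]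
  conv_rhs => rw [← card_range n, ← prod_const, card_range, ← prod_mul_distrib]
  exact prod_congr rfl fun k _ => by ring

theorem qPoch_succ (a p : ℂ) (n : ℕ) : qPoch a p (n + 1) = qPoch a p n * (1 - a * p ^ n) :=
  prod_range_succ _ _

theorem qPoch_succ' (a p : ℂ) (n : ℕ) : qPoch a p (n + 1) = (1 - a) * qPoch (a * p) p n := by
  rw [add_comm, qPoch_add]; simp [qPoch]

theorem qPochInf_eq_one_sub_mul (a : ℂ) {p : ℂ} (hp : ‖p‖ < 1) :
    qPochInf a p = (1 - a) * qPochInf (a * p) p := by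
  rw [qPochInf_eq_mul a p hp 1]; simp [qPoch]

section SpecialCases

variable {q : ℝ} (hq0 : 0 < q) (hq1 : q < 1)

include hq0 hq1 in
theorem transformation_zero_zero : ∃ S : ℂ,
    HasSum (fun n : ℕ =>
      ∑ j ∈ Icc (-(n : ℤ)) (n : ℤ),
        (1 - (q : ℂ) ^ (4 * n + 2)) * (q : ℂ) ^ (4 * (n : ℤ) ^ 2 - 2 * j ^ 2 + 2 * (n : ℤ) - j)) S ∧
    HasSum (fun n : ℕ => (q : ℂ) ^ (2 * n ^ 2 + n) / qPoch (q : ℂ) (q : ℂ) (2 * n))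
      (1 / qPochInf ((q : ℂ) ^ 2) ((q : ℂ) ^ 2) * S) := by
  have hq : (q : ℂ) ≠ 0 := by exact_mod_cast hq0.ne'
  have hn : ‖(q : ℂ)‖ < 1 := by simpa [abs_of_pos hq0] using hq1
  have hp := norm_sq_lt_one hn
  have n1 := qPochInf_ne_zero hp (one_sub_mul_pow_ne_zero hp hp)
  obtain ⟨h1, h2⟩ := transformation hq0 hq1 0 0 (by simp) (by simp) (by simp)
  have ht : ∀ n, transTerm q 0 0 n = (q : ℂ) ^ (2 * n ^ 2 + 2 * n) := fun n => by
    rw [transTerm, qPochDivMulPow_sq_zero, mul_mul_mul_comm, ← mul_pow, neg_one_mul, neg_neg,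
      one_pow, one_mul, ← pow_add]
    congr 1; ring
  refine ⟨_, h2.congr_fun fun n => ?_, ?_⟩
  · rw [ht, mul_zero, qPoch_zero_left, one_mul, div_one, baileyAlpha, sum_mul]
    refine sum_congr rfl fun j _ => ?_
    rw [mul_assoc, ← zpow_natCast (q : ℂ) (2 * n ^ 2 + 2 * n), ← zpow_add₀ hq]
    congr 2; push_cast; ring
  · have h3 := h1.hasSum
    rw [mul_zero, mul_zero, qPochInf_zero_left, mul_one, mul_one, div_one, one_div_mul_eq_div,
      mul_div_cancel_left₀ _ n1]
    refine h3.congr_fun fun n => ?_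
    rw [ht, show 2 * n ^ 2 + 2 * n = 2 * n ^ 2 + n + n by ring, pow_add _ (2 * n ^ 2 + n), mul_assoc,
      ← mul_pow, mul_one_div_cancel hq, one_pow, mul_one]

include hq0 hq1 in
theorem transformation_one_zero : ∃ S : ℂ,
    HasSum (fun n : ℕ =>
      ∑ j ∈ Icc (-(n : ℤ)) (n : ℤ),
        (-1 : ℂ) ^ n * (1 - (q : ℂ) ^ (4 * n + 2)) *
          (q : ℂ) ^ (3 * (n : ℤ) ^ 2 - 2 * j ^ 2 + (n : ℤ) - j)) S ∧
    HasSum (fun n : ℕ => (-1 : ℂ) ^ n * (q : ℂ) ^ (n ^ 2) / qPoch (q : ℂ) ((q : ℂ) ^ 2) n) S := by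
  have hq : (q : ℂ) ≠ 0 := by exact_mod_cast hq0.ne'
  have hn : ‖(q : ℂ)‖ < 1 := by simpa [abs_of_pos hq0] using hq1
  have hp := norm_sq_lt_one hn
  have n1 := qPochInf_ne_zero hp (one_sub_mul_pow_ne_zero hp hp)
  obtain ⟨h1, h2⟩ := transformation hq0 hq1 1 0 (by simp)
    (by simpa using one_sub_mul_pow_ne_zero hp hp) (by simp)
  have ht : ∀ n, transTerm q 1 0 n =
      qPoch ((q : ℂ) ^ 2) ((q : ℂ) ^ 2) n * ((-1) ^ n * (q : ℂ) ^ (n ^ 2 + n)) := fun n => by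
    rw [transTerm, qPochDivMulPow_sq_zero, qPochDivMulPow_one]
  rw [mul_zero, mul_zero, mul_one, qPochInf_zero_left, mul_one, div_self n1, one_mul] at h2
  refine ⟨_, h2.congr_fun fun n => ?_, h1.hasSum.congr_fun fun n => ?_⟩
  · have n2 := qPoch_self_ne_zero hp n
    rw [ht, qPoch_zero_left, mul_one, mul_left_comm, mul_div_cancel_left₀ _ n2, baileyAlpha, sum_mul]
    refine sum_congr rfl fun j _ => ?_
    have : (q : ℂ) ^ (3 * (n : ℤ) ^ 2 - 2 * j ^ 2 + (n : ℤ) - j) =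
        (q : ℂ) ^ (2 * (n : ℤ) ^ 2 - 2 * j ^ 2 - j) * (q : ℂ) ^ (n ^ 2 + n) := by
      rw [← zpow_natCast (q : ℂ) (n ^ 2 + n), ← zpow_add₀ hq]
      congr 1; push_cast; ring
    rw [this]; ring
  · have n2 := qPoch_self_ne_zero hn (2 * n)
    have n3 := qPoch_self_ne_zero hp n
    rw [qPoch_two_mul] at n2 ⊢
    have n4 := left_ne_zero_of_mul n2
    rw [ht, pow_add, one_div, inv_pow]
    field_simp

include hq0 hq1 in
theorem transformation_self_neg : ∃ S : ℂ,
    HasSum (fun n : ℕ =>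
      ∑ j ∈ Icc (-(n : ℤ)) (n : ℤ),
        (-1 : ℂ) ^ n * (q : ℂ) ^ (2 * (n : ℤ) ^ 2 + 2 * (n : ℤ) - 2 * j ^ 2 - j)) S ∧
    HasSum (fun n : ℕ =>
        qPoch ((q : ℂ) ^ 2) ((q : ℂ) ^ 4) n * (-(q : ℂ)) ^ n / qPoch (q : ℂ) (q : ℂ) (2 * n))
      (qPochInf ((q : ℂ) ^ 2) ((q : ℂ) ^ 4) / qPochInf ((q : ℂ) ^ 4) ((q : ℂ) ^ 4) * S) := by
  have hq : (q : ℂ) ≠ 0 := by exact_mod_cast hq0.ne'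
  have hn : ‖(q : ℂ)‖ < 1 := by simpa [abs_of_pos hq0] using hq1
  have hp := norm_sq_lt_one hn
  have e4 : ((q : ℂ) ^ 2) ^ 2 = (q : ℂ) ^ 4 := by ring
  have hp4 : ‖(q : ℂ) ^ 4‖ < 1 := e4 ▸ norm_sq_lt_one hp
  have hq3 : ‖(q : ℂ) ^ 2 * q‖ < 1 := by
    rw [norm_mul]; nlinarith [norm_nonneg (q : ℂ), norm_nonneg ((q : ℂ) ^ 2)]
  obtain ⟨h1, h2⟩ := transformation hq0 hq1 q (-q)
    (by rw [mul_neg, ← neg_mul, mul_div_cancel_right₀ _ hq, norm_neg]; exact hn)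
    (one_sub_mul_pow_ne_zero hq3 hp)
    (one_sub_mul_pow_ne_zero (by rwa [mul_neg, norm_neg]) hp)
  -- The denominator is `(q^6; q^4)_n`; prefixing `1 - q²` makes it `(q²; q^4)_{n+1}`. This cancels
  -- both `(q²; q^4)_n` from `transTerm` and `1 - q^{4n+2}` from `baileyAlpha`.
  have hpoch : ∀ n, (1 - (q : ℂ) ^ 2) * (qPoch ((q : ℂ) ^ 2 * q) ((q : ℂ) ^ 2) n *
      qPoch ((q : ℂ) ^ 2 * -q) ((q : ℂ) ^ 2) n) =
      qPoch ((q : ℂ) ^ 2) ((q : ℂ) ^ 4) n * (1 - (q : ℂ) ^ (4 * n + 2)) := fun n => by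
    have := qPoch_succ' ((q : ℂ) ^ 2) ((q : ℂ) ^ 4) n
    rw [qPoch_succ] at this
    rw [mul_neg, qPoch_mul_neg, e4, show ((q : ℂ) ^ 2 * q) ^ 2 = (q : ℂ) ^ 2 * (q : ℂ) ^ 4 by ring,
      ← this, ← pow_mul, ← pow_add, add_comm]
  have hinf : (1 - (q : ℂ) ^ 2) * (qPochInf ((q : ℂ) ^ 2 * q) ((q : ℂ) ^ 2) *
      qPochInf ((q : ℂ) ^ 2 * -q) ((q : ℂ) ^ 2)) = qPochInf ((q : ℂ) ^ 2) ((q : ℂ) ^ 4) := by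
    rw [mul_neg, qPochInf_mul_neg _ hp, e4,
      show ((q : ℂ) ^ 2 * q) ^ 2 = (q : ℂ) ^ 2 * (q : ℂ) ^ 4 by ring,
      ← qPochInf_eq_one_sub_mul _ hp4]
  have hnum : qPochInf ((q : ℂ) ^ 2) ((q : ℂ) ^ 2) * qPochInf (q * -q) ((q : ℂ) ^ 2) =
      qPochInf ((q : ℂ) ^ 4) ((q : ℂ) ^ 4) := by
    rw [mul_neg, ← sq, qPochInf_mul_neg _ hp, e4]
  have n1 : 1 - (q : ℂ) ^ 2 ≠ 0 := by simpa using one_sub_mul_pow_ne_zero hp hp 0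
  have n2 := qPochInf_ne_zero hp4 (one_sub_mul_pow_ne_zero hp4 hp4)
  have n3 := qPochInf_ne_zero hp4 (one_sub_mul_pow_ne_zero hp hp4)
  rw [hnum] at h2
  -- The factor `1 - q²` borrowed from the finite products is returned here, and `hinf` absorbs it
  -- into `(q²; q^4)_∞`.
  refine ⟨_, (h2.mul_left (1 - (q : ℂ) ^ 2)⁻¹).congr_fun fun n => ?_, ?_⟩
  · have n4 := qPoch_ne_zero (one_sub_mul_pow_ne_zero hp hp4) n
    have n5 : 1 - (q : ℂ) ^ (4 * n + 2) ≠ 0 := by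
      have := one_sub_mul_pow_ne_zero hp hp4 n
      rwa [← pow_mul, ← pow_add, add_comm] at this
    rw [← div_eq_inv_mul, div_div, mul_comm _ (1 - (q : ℂ) ^ 2), hpoch, transTerm_self_neg,
      baileyAlpha, ← mul_sum, ← mul_sum]
    have : ∑ j ∈ Icc (-(n : ℤ)) n, (q : ℂ) ^ (2 * (n : ℤ) ^ 2 + 2 * (n : ℤ) - 2 * j ^ 2 - j) =
        (q : ℂ) ^ (2 * n) * ∑ j ∈ Icc (-(n : ℤ)) n, (q : ℂ) ^ (2 * (n : ℤ) ^ 2 - 2 * j ^ 2 - j) := by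
      rw [mul_sum]
      refine sum_congr rfl fun j _ => ?_
      rw [← zpow_natCast (q : ℂ) (2 * n), ← zpow_add₀ hq]
      congr 1; push_cast; ring
    rw [this, neg_pow ((q : ℂ) ^ 2), pow_mul]
    field_simp
  · have hD : qPochInf ((q : ℂ) ^ 2 * q) ((q : ℂ) ^ 2) *
        qPochInf ((q : ℂ) ^ 2 * -q) ((q : ℂ) ^ 2) =
        qPochInf ((q : ℂ) ^ 2) ((q : ℂ) ^ 4) / (1 - (q : ℂ) ^ 2) := by
      rw [← hinf, mul_div_cancel_left₀ _ n1]
    rw [hD]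
    convert h1.hasSum using 1
    · funext n
      rw [transTerm_self_neg, one_div, inv_pow, neg_pow, neg_pow ((q : ℂ) ^ 2), ← pow_mul,
        pow_mul']
      field_simp
    · field_simp

end SpecialCases

end

theorem mainTheorem9 (q : ℝ) (hq0 : 0 < q) (hq1 : q < 1) :
    -- the general transformation formula
    (∀ a b : ℂ, ‖a * b / (q : ℂ)‖ < 1 →
      (∀ k : ℕ, 1 - (q : ℂ) ^ 2 * a * ((q : ℂ) ^ 2) ^ k ≠ 0) →
      (∀ k : ℕ, 1 - (q : ℂ) ^ 2 * b * ((q : ℂ) ^ 2) ^ k ≠ 0) →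
      Summable (fun n : ℕ =>
          qPochDivMulPow ((q : ℂ) ^ 2) a ((q : ℂ) ^ 2) n *
            qPochDivMulPow ((q : ℂ) ^ 2) b ((q : ℂ) ^ 2) n *
            (1 / (q : ℂ)) ^ n / qPoch (q : ℂ) (q : ℂ) (2 * n)) ∧
      HasSum (fun n : ℕ =>
          ∑ j ∈ Finset.Icc (-(n : ℤ)) (n : ℤ),
            (1 - (q : ℂ) ^ (4 * n + 2)) * (q : ℂ) ^ (2 * (n : ℤ) ^ 2 - 2 * j ^ 2 - j) *
              (qPochDivMulPow ((q : ℂ) ^ 2) a ((q : ℂ) ^ 2) n *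
                qPochDivMulPow ((q : ℂ) ^ 2) b ((q : ℂ) ^ 2) n) /
              (qPoch ((q : ℂ) ^ 2 * a) ((q : ℂ) ^ 2) n *
                qPoch ((q : ℂ) ^ 2 * b) ((q : ℂ) ^ 2) n))
        (qPochInf ((q : ℂ) ^ 2) ((q : ℂ) ^ 2) * qPochInf (a * b) ((q : ℂ) ^ 2) /
            (qPochInf ((q : ℂ) ^ 2 * a) ((q : ℂ) ^ 2) *
              qPochInf ((q : ℂ) ^ 2 * b) ((q : ℂ) ^ 2)) *
          ∑' n : ℕ,
            qPochDivMulPow ((q : ℂ) ^ 2) a ((q : ℂ) ^ 2) n *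
              qPochDivMulPow ((q : ℂ) ^ 2) b ((q : ℂ) ^ 2) n *
              (1 / (q : ℂ)) ^ n / qPoch (q : ℂ) (q : ℂ) (2 * n))) ∧
    -- the case `(a, b) = (0, 0)`
    (∃ S : ℂ,
      HasSum (fun n : ℕ =>
          ∑ j ∈ Finset.Icc (-(n : ℤ)) (n : ℤ),
            (1 - (q : ℂ) ^ (4 * n + 2)) *
              (q : ℂ) ^ (4 * (n : ℤ) ^ 2 - 2 * j ^ 2 + 2 * (n : ℤ) - j)) S ∧
      HasSum (fun n : ℕ =>
          (q : ℂ) ^ (2 * n ^ 2 + n) / qPoch (q : ℂ) (q : ℂ) (2 * n))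
        (1 / qPochInf ((q : ℂ) ^ 2) ((q : ℂ) ^ 2) * S)) ∧
    -- the case `(a, b) = (1, 0)`
    (∃ S : ℂ,
      HasSum (fun n : ℕ =>
          ∑ j ∈ Finset.Icc (-(n : ℤ)) (n : ℤ),
            (-1 : ℂ) ^ n * (1 - (q : ℂ) ^ (4 * n + 2)) *
              (q : ℂ) ^ (3 * (n : ℤ) ^ 2 - 2 * j ^ 2 + (n : ℤ) - j)) S ∧
      HasSum (fun n : ℕ =>
          (-1 : ℂ) ^ n * (q : ℂ) ^ (n ^ 2) / qPoch (q : ℂ) ((q : ℂ) ^ 2) n) S) ∧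
    -- the case `(a, b) = (q, -q)`
    (∃ S : ℂ,
      HasSum (fun n : ℕ =>
          ∑ j ∈ Finset.Icc (-(n : ℤ)) (n : ℤ),
            (-1 : ℂ) ^ n *
              (q : ℂ) ^ (2 * (n : ℤ) ^ 2 + 2 * (n : ℤ) - 2 * j ^ 2 - j)) S ∧
      HasSum (fun n : ℕ =>
          qPoch ((q : ℂ) ^ 2) ((q : ℂ) ^ 4) n * (-(q : ℂ)) ^ n /
            qPoch (q : ℂ) (q : ℂ) (2 * n))
        (qPochInf ((q : ℂ) ^ 2) ((q : ℂ) ^ 4) / qPochInf ((q : ℂ) ^ 4) ((q : ℂ) ^ 4) * S)) := by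
  refine ⟨fun a b hab ha hb => ?_, transformation_zero_zero hq0 hq1,
    transformation_one_zero hq0 hq1, transformation_self_neg hq0 hq1⟩
  obtain ⟨h1, h2⟩ := transformation hq0 hq1 a b hab ha hb
  refine ⟨h1, h2.congr_fun fun n => ?_⟩
  rw [baileyAlpha, transTerm, Finset.sum_mul, Finset.sum_div]
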